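/- Let $\Omega\subset\mathbb{R}^n$ be a bounded open set (for instance a bounded domain) that is smoothly bounded, i.e. there is a $C^\infty$ function $r:\mathbb{R}^n\to\mathbb{R}$ with $\Omega=\{r<0\}$, $\{r=0\}=b\Omega$ (the topological boundary) and $\nabla r\neq 0$ in a neighborhood of $b\Omega$. Let $\delta$ be the signed distance to the boundary, $\delta(x)=-\operatorname{dist}(x,b\Omega)$ for $x\in\Omega$ and $\delta(x)=\operatorname{dist}(x,b\Omega)$ for $x\in\mathbb{R}^n\setminus\Omega$, and write $\mathcal{H}_x=\bigl(\frac{\partial^2\delta}{\partial x_j\partial x_k}(x)\bigr)_{1\le j,k\le n}$ for its Hessian matrix. Then there is an open neighborhood $U$ of $b\Omega$ such that $\delta$ is $C^\infty$ on $U$, every $x\in U$ has a unique nearest boundary point $b(x)\in b\Omega$ (that is, $\|b(x)-x\|=|\delta(x)|$), and for every $x\in U$ the series below converges, the matrix $I+\delta(x)\mathcal{H}_{b(x)}$ is invertible, and $$\mathcal{H}_x=\mathcal{H}_{b(x)}\cdot\Bigl(\sum_{m=0}^{\infty}(-\delta(x))^m\,\mathcal{H}_{b(x)}^m\Bigr)=\mathcal{H}_{b(x)}\cdot\bigl(I+\delta(x)\mathcal{H}_{b(x)}\bigr)^{-1},$$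 where $I$ is the $n\times n$ identity matrix. -/

import Mathlib

open scoped ContDiff Topology

noncomputable section

/-- An open set `Ω ⊆ ℝⁿ` is smoothly bounded if it admits a defining function `r` on `ℝⁿ`
(that is, `Ω = {r < 0}`) of class `C^∞` such that `{r = 0}` is the boundary of `Ω` and
`∇r ≠ 0` in a neighborhood of that set. -/
def IsSmoothlyBounded {n : ℕ} (Ω : Set (EuclideanSpace ℝ (Fin n))) : Prop :=
  IsOpen Ω ∧
    ∃ r : EuclideanSpace ℝ (Fin n) → ℝ,
      ContDiff ℝ ∞ r ∧
      Ω = {x | r x < 0} ∧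
      {x | r x = 0} = frontier Ω ∧
      ∃ W : Set (EuclideanSpace ℝ (Fin n)),
        IsOpen W ∧ {x | r x = 0} ⊆ W ∧ ∀ x ∈ W, gradient r x ≠ 0

open Classical in
/-- The signed Euclidean distance to the boundary of `Ω`: negative in `Ω`, nonnegative
outside `Ω`. -/
def signedDistance {n : ℕ} (Ω : Set (EuclideanSpace ℝ (Fin n)))
    (x : EuclideanSpace ℝ (Fin n)) : ℝ :=
  if x ∈ Ω then -Metric.infDist x (frontier Ω) else Metric.infDist x (frontier Ω)

/-- The partial derivative `∂f/∂x_j`. -/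
def partialDerivative {n : ℕ} (j : Fin n) (f : EuclideanSpace ℝ (Fin n) → ℝ)
    (x : EuclideanSpace ℝ (Fin n)) : ℝ :=
  fderiv ℝ f x (EuclideanSpace.single j 1)

/-- The Hessian matrix `(∂²f/∂x_j∂x_k (x))_{j,k}`. -/
def hessianMatrix {n : ℕ} (f : EuclideanSpace ℝ (Fin n) → ℝ)
    (x : EuclideanSpace ℝ (Fin n)) : Matrix (Fin n) (Fin n) ℝ :=
  Matrix.of fun j k => partialDerivative j (partialDerivative k f) x

end

/-! ### Nearest points on a regular level set. -/

section LevelSet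

variable {E : Type*} [NormedAddCommGroup E] [InnerProductSpace ℝ E] [FiniteDimensional ℝ E]

/-! A nearest boundary point `q` of `x` satisfies `x = q + t∇r(q)` by Lagrange multipliers, so `(q,
t)` is recovered by inverting `normalLevelMap r` at `(x, 0)`. Near the boundary this gives smooth
`b` and `δ` with `x = b(x) + δ(x)ν(x)`, where `ν(x)` is the unit normal at `b(x)`
(`exists_tubular_neighborhood`).

Differentiating and pairing with `ν` gives `∇δ = ν`, so the Hessian is `A = Dν(x)`. Put `B =
Dν(b(x))`. Since `ν = ν ∘ b` and `Bν = 0`, the chain rule yields `A = B - δBA` (`fderiv_normal_eq`),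
that is `(1 + δB)A = B`. Where `‖δB‖ < 1` the Neumann series solves this
(`eq_mul_tsum_of_eq_sub_smul_mul`). -/

theorem ContDiff.gradient_infty {r : E → ℝ} (hr : ContDiff ℝ ∞ r) :
    ContDiff ℝ ∞ (gradient r) :=
  (InnerProductSpace.toDual ℝ E).symm.toContinuousLinearEquiv.contDiff.comp
    (hr.fderiv_right (m := ∞) le_rfl)

/-- Lagrange multipliers: a point is displaced from a nearest point of a regular level set along
the gradient. -/
theorem exists_eq_add_smul_gradient_of_nearest {r : E → ℝ} (hr : ContDiff ℝ ∞ r) {x q : E}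
    (hq : r q = 0) (hmin : ∀ p, r p = 0 → dist x q ≤ dist x p) (hg : gradient r q ≠ 0) :
    ∃ t : ℝ, x = q + t • gradient r q := by
  have hext : IsLocalExtrOn (fun y : E => ‖y - x‖ ^ 2) {y | r y = r q} q := by
    refine Or.inl (Filter.eventually_of_mem self_mem_nhdsWithin fun y hy => ?_)
    have h := hmin y (hy.trans hq)
    rw [dist_comm x q, dist_comm x y, dist_eq_norm, dist_eq_norm] at h
    exact pow_le_pow_left₀ (norm_nonneg _) h 2
  have hr' : HasStrictFDerivAt r (fderiv ℝ r q) q :=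
    (hr.contDiffAt.hasStrictFDerivAt (by simp))
  have hφ : HasStrictFDerivAt (fun y : E => ‖y - x‖ ^ 2) (2 • innerSL ℝ (q - x)) q := by
    have h := (hasStrictFDerivAt_norm_sq (q - x)).comp q ((hasStrictFDerivAt_id q).sub_const x)
    exact h
  obtain ⟨a, b, hab, h⟩ := hext.exists_multipliers_of_hasStrictFDerivAt_1d hr' hφ
  have hvec : a • gradient r q + (2 * b) • (q - x) = 0 := by
    refine ext_inner_right ℝ fun v => ?_
    have := congrArg (fun L : StrongDual ℝ E => L v) h
    simp only [add_apply, smul_apply, smul_eq_mul,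
      innerSL_apply_apply, zero_apply, nsmul_eq_mul] at this
    rw [inner_add_left, inner_smul_left, inner_smul_left, inner_gradient_left, inner_zero_left]
    simp only [conj_trivial]
    push_cast at this
    linarith
  have hb : b ≠ 0 := by
    rintro rfl
    have : a ≠ 0 := by rintro rfl; exact hab rfl
    simp [this, hg] at hvec
  refine ⟨a / (2 * b), ?_⟩
  have h2 : (2 * b) • (x - q) = a • gradient r q := by
    rw [← sub_eq_zero, ← neg_eq_zero, ← hvec]; module
  rw [div_eq_inv_mul, mul_smul, ← h2, smul_smul, inv_mul_cancel₀ (by simpa using hb)]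
  module

/-- The map sending `(y, t)` to the point at parameter `t` on the line through `y` normal to the
level set of `r`, paired with the level `r y`. -/
noncomputable def normalLevelMap (r : E → ℝ) (z : E × ℝ) : E × ℝ :=
  (z.1 + z.2 • gradient r z.1, r z.1)

theorem contDiff_normalLevelMap {r : E → ℝ} (hr : ContDiff ℝ ∞ r) :
    ContDiff ℝ ∞ (normalLevelMap r) :=
  (contDiff_fst.add (contDiff_snd.smul (hr.gradient_infty.comp contDiff_fst))).prodMk
    (hr.comp contDiff_fst)

/-- At `t = 0` the derivative is `(v, s) ↦ (v + s∇r, ⟨∇r, v⟩)`. On its kernel `v = -s∇r`, so `s‖∇r‖²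
= 0` and both vanish; in finite dimension injectivity suffices. -/
theorem exists_equiv_hasFDerivAt_normalLevelMap {r : E → ℝ} (hr : ContDiff ℝ ∞ r) {p : E}
    (hg : gradient r p ≠ 0) :
    ∃ e : (E × ℝ) ≃L[ℝ] E × ℝ,
      HasFDerivAt (normalLevelMap r) (e : E × ℝ →L[ℝ] E × ℝ) (p, 0) := by
  have hd : HasFDerivAt (gradient r) (fderiv ℝ (gradient r) p) (p, (0 : ℝ)).1 :=
    (hr.gradient_infty.differentiable (by simp) p).hasFDerivAt
  have hrd : HasFDerivAt r (fderiv ℝ r p) (p, (0 : ℝ)).1 :=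
    (hr.differentiable (by simp) p).hasFDerivAt
  have h1 := (hasFDerivAt_fst (𝕜 := ℝ) (p := (p, (0 : ℝ)))).add
    ((hasFDerivAt_snd (𝕜 := ℝ) (p := (p, (0 : ℝ)))).smul (hd.comp _ hasFDerivAt_fst))
  have h2 := h1.prodMk (hrd.comp _ hasFDerivAt_fst)
  set L : E × ℝ →L[ℝ] E × ℝ := ContinuousLinearMap.prod _ _ with hL
  have hinj : Function.Injective (L : E × ℝ →ₗ[ℝ] E × ℝ) := by
    rw [injective_iff_map_eq_zero]
    rintro ⟨v, s⟩ hv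
    have hv1 : v + s • gradient r p = 0 := by
      simpa [hL] using congrArg Prod.fst hv
    have hv2 : fderiv ℝ r p v = 0 := by
      simpa [hL] using congrArg Prod.snd hv
    rw [← inner_gradient_left, eq_neg_of_add_eq_zero_left hv1, inner_neg_right,
      inner_smul_right] at hv2
    have hs : s = 0 := by simpa [hg] using hv2
    subst hs
    simpa using hv1
  refine ⟨(LinearEquiv.ofInjectiveEndo _ hinj).toContinuousLinearEquiv, ?_⟩
  have he : ((LinearEquiv.ofInjectiveEndo _ hinj).toContinuousLinearEquiv :
      E × ℝ →L[ℝ] E × ℝ) = L := by ext <;> rfl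
  rw [he]
  exact h2

/-- Near a regular point of its level set, the normal map is a diffeomorphism. -/
theorem exists_openPartialHomeomorph_normalLevelMap {r : E → ℝ} (hr : ContDiff ℝ ∞ r) {p : E}
    (hg : gradient r p ≠ 0) :
    ∃ Φ : OpenPartialHomeomorph (E × ℝ) (E × ℝ), (p, (0 : ℝ)) ∈ Φ.source ∧
      (∀ z, Φ z = normalLevelMap r z) ∧ ContDiffOn ℝ ∞ Φ.symm Φ.target := by
  have hF := contDiff_normalLevelMap hr
  obtain ⟨e, he⟩ := exists_equiv_hasFDerivAt_normalLevelMap hr hg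
  have hcont : Continuous (fderiv ℝ (normalLevelMap r)) := hF.continuous_fderiv (by simp)
  -- Restricting to points with invertible derivative makes the inverse smooth on the whole target,
  -- not only at the image of `(p, 0)`.
  set O := fderiv ℝ (normalLevelMap r) ⁻¹'
    Set.range ((↑) : ((E × ℝ) ≃L[ℝ] E × ℝ) → (E × ℝ →L[ℝ] E × ℝ)) with hO
  have hOo : IsOpen O := ContinuousLinearEquiv.isOpen.preimage hcont
  set Ψ := (hF.contDiffAt (x := (p, (0 : ℝ)))).toOpenPartialHomeomorph _ he (by simp) with hΨ
  have hΨc : ∀ z, Ψ z = normalLevelMap r z := fun z => rfl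
  refine ⟨Ψ.restrOpen O hOo, ?_, hΨc, ?_⟩
  · refine ⟨ContDiffAt.mem_toOpenPartialHomeomorph_source _ he (by simp), ?_⟩
    exact ⟨e, he.fderiv.symm⟩
  · intro w hw
    have hs := (Ψ.restrOpen O hOo).map_target hw
    obtain ⟨e', he'⟩ := hs.2
    refine (OpenPartialHomeomorph.contDiffAt_symm (f₀' := e') _ hw ?_ ?_).contDiffWithinAt
    · rw [he']
      exact (hF.differentiable (by simp) _).hasFDerivAt
    · exact hF.contDiffAt

/-- Along a gradient direction the sign of `r` is that of the parameter, as long as the gradients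
point into a common half space. -/
theorem neg_iff_of_gradient_inner_pos {r : E → ℝ} (hr : ContDiff ℝ ∞ r) {B : Set E}
    (hB : Convex ℝ B)
    (hpos : ∀ y ∈ B, ∀ z ∈ B, 0 < inner ℝ (gradient r y) (gradient r z))
    {q : E} {t : ℝ} (hq : q ∈ B) (hx : q + t • gradient r q ∈ B) (hrq : r q = 0) :
    r (q + t • gradient r q) < 0 ↔ t < 0 := by
  set D : Set ℝ := {s | q + s • gradient r q ∈ B} with hD
  have hcurve : ∀ s : ℝ, HasDerivAt (fun s : ℝ => q + s • gradient r q) (gradient r q) s :=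
    fun s => by simpa using ((hasDerivAt_id s).smul_const (gradient r q)).const_add q
  have hderiv : ∀ s : ℝ, HasDerivAt (fun s : ℝ => r (q + s • gradient r q))
      (inner ℝ (gradient r (q + s • gradient r q)) (gradient r q)) s := fun s => by
    rw [inner_gradient_left]
    exact (hr.differentiable (by simp) _).hasFDerivAt.comp_hasDerivAt s (hcurve s)
  have hDc : Convex ℝ D := by
    intro s hs s' hs' a b ha hb hab
    have := hB hs hs' ha hb hab
    have h2 : a • (q + s • gradient r q) + b • (q + s' • gradient r q)
        = q + (a • s + b • s') • gradient r q := by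
      rw [show q + (a • s + b • s') • gradient r q
        = (a + b) • q + (a • s + b • s') • gradient r q by rw [hab, one_smul]]
      simp only [smul_eq_mul]
      module
    rwa [h2] at this
  have hmono : StrictMonoOn (fun s : ℝ => r (q + s • gradient r q)) D := by
    refine strictMonoOn_of_deriv_pos hDc (fun s _ => (hderiv s).continuousAt.continuousWithinAt) ?_
    intro s hs
    rw [(hderiv s).deriv]
    exact hpos _ (show s ∈ D from interior_subset hs) _ hq
  have h0 : (0 : ℝ) ∈ D := by simpa [hD] using hq
  have := hmono.lt_iff_lt (a := t) (b := 0) hx h0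
  simpa [hrq] using this

/-- Near a regular point of a level set, nearest points on the level set are unique and depend
smoothly on the point. -/
theorem exists_smooth_nearest_point {r : E → ℝ} (hr : ContDiff ℝ ∞ r) {p : E} (hp : r p = 0)
    (hg : gradient r p ≠ 0) :
    ∃ (V : Set E) (y : E → E) (t : E → ℝ), IsOpen V ∧ p ∈ V ∧ ContDiffOn ℝ ∞ y V ∧
      ContDiffOn ℝ ∞ t V ∧ ∀ x ∈ V, ∀ q, r q = 0 → (∀ p', r p' = 0 → dist x q ≤ dist x p') →
        q = y x ∧ x = q + t x • gradient r q ∧ gradient r q ≠ 0 ∧ (r x < 0 ↔ t x < 0) := by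
  obtain ⟨Φ, hpΦ, hΦ, hsymm⟩ := exists_openPartialHomeomorph_normalLevelMap hr hg
  have hgc : Continuous (gradient r) := hr.gradient_infty.continuous
  have hg0 : 0 < ‖gradient r p‖ := norm_pos_iff.2 hg
  set c := ‖gradient r p‖ / 2 with hc
  have hc0 : 0 < c := half_pos hg0
  have hev : ∀ᶠ z : E × ℝ in 𝓝 (p, 0), z ∈ Φ.source := Φ.open_source.mem_nhds hpΦ
  have hnorm : ∀ᶠ y in 𝓝 p, c < ‖gradient r y‖ :=
    hgc.norm.continuousAt.eventually (lt_mem_nhds (half_lt_self hg0))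
  have hinner : ∀ᶠ z : E × E in 𝓝 (p, p), 0 < inner ℝ (gradient r z.1) (gradient r z.2) := by
    have hct : Continuous fun z : E × E => inner ℝ (gradient r z.1) (gradient r z.2) := by
      fun_prop
    exact hct.continuousAt.eventually (lt_mem_nhds (real_inner_self_pos.2 hg))
  obtain ⟨ε₁, hε₁, h1⟩ := Metric.eventually_nhds_iff_ball.1 hev
  obtain ⟨ε₂, hε₂, h2⟩ := Metric.eventually_nhds_iff_ball.1 hnorm
  obtain ⟨ε₃, hε₃, h3⟩ := Metric.eventually_nhds_iff_ball.1 hinner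
  -- As `q` lies within `2η` of `p`, the halves put it in all three balls; `ε₁ * c` forces `|t| <
  -- ε₁` because `‖∇r(q)‖ > c`.
  set η := min (min (ε₁ / 2) (ε₁ * c)) (min (ε₂ / 2) (ε₃ / 2)) with hη
  have hη0 : 0 < η := by positivity
  have hη1 : η ≤ ε₁ / 2 := (min_le_left _ _).trans (min_le_left _ _)
  have hη1' : η ≤ ε₁ * c := (min_le_left _ _).trans (min_le_right _ _)
  have hη2 : η ≤ ε₂ / 2 := (min_le_right _ _).trans (min_le_left _ _)
  have hη3 : η ≤ ε₃ / 2 := (min_le_right _ _).trans (min_le_right _ _)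
  have hι : ContDiff ℝ ∞ fun x : E => (x, (0 : ℝ)) := contDiff_id.prodMk contDiff_const
  set V := Metric.ball p η ∩ (fun x : E => (x, (0 : ℝ))) ⁻¹' Φ.target with hV
  have hcomp : ContDiffOn ℝ ∞ (fun x : E => Φ.symm (x, (0 : ℝ))) V :=
    hsymm.comp hι.contDiffOn fun x hx => hx.2
  refine ⟨V, fun x => (Φ.symm (x, 0)).1, fun x => (Φ.symm (x, 0)).2,
    Metric.isOpen_ball.inter (Φ.open_target.preimage hι.continuous), ⟨Metric.mem_ball_self hη0, ?_⟩,
    hcomp.fst, hcomp.snd, ?_⟩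
  · have := Φ.map_source hpΦ
    rw [hΦ] at this
    simpa [normalLevelMap, hp] using this
  rintro x ⟨hxp, -⟩ q hq hmin
  have hxp : dist x p < η := hxp
  have hxq : dist x q < η := (hmin p hp).trans_lt hxp
  have hqp : dist q p < 2 * η := by
    linarith [dist_triangle q x p, dist_comm q x]
  have hcq : c < ‖gradient r q‖ := h2 q (Metric.mem_ball.2 (by linarith))
  have hgq : gradient r q ≠ 0 := norm_pos_iff.1 (hc0.trans hcq)
  obtain ⟨t, ht⟩ := exists_eq_add_smul_gradient_of_nearest hr hq hmin hgq
  have htnorm : |t| * ‖gradient r q‖ < ε₁ * c := by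
    have : dist x q = |t| * ‖gradient r q‖ := by
      conv_lhs => rw [ht]
      simp [norm_smul]
    linarith
  have ht1 : |t| < ε₁ := by
    by_contra! hcon
    have := mul_le_mul hcon hcq.le hc0.le (abs_nonneg t)
    linarith
  have hsrc : (q, t) ∈ Φ.source := by
    refine h1 _ ?_
    rw [Metric.mem_ball, Prod.dist_eq, max_lt_iff]
    exact ⟨by simpa using by linarith, by simpa using ht1⟩
  have hinv : Φ.symm (x, 0) = (q, t) := by
    rw [← Φ.left_inv hsrc, hΦ]
    simp only [normalLevelMap, hq, ← ht]
  simp only [hinv]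
  refine ⟨trivial, ht, hgq, ?_⟩
  have := neg_iff_of_gradient_inner_pos hr (B := Metric.ball p ε₃) (q := q) (t := t)
    (convex_ball p ε₃)
    (fun y hy z hz => h3 (y, z) (by
      rw [Metric.mem_ball, Prod.dist_eq, max_lt_iff]; exact ⟨hy, hz⟩))
    (Metric.mem_ball.2 (by linarith)) (by rw [← ht]; exact Metric.mem_ball.2 (by linarith)) hq
  rwa [← ht] at this

end LevelSet

/-! ### Smooth projection and signed distance near the boundary. -/

section Tubular

variable {n : ℕ}

theorem abs_signedDistance (Ω : Set (EuclideanSpace ℝ (Fin n))) (x : EuclideanSpace ℝ (Fin n)) :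
    |signedDistance Ω x| = Metric.infDist x (frontier Ω) := by
  unfold signedDistance
  split_ifs <;> simp [abs_of_nonneg Metric.infDist_nonneg]

/-- Near the boundary the nearest point projection `b` and the signed distance are smooth, and
points are displaced from their projection by the signed distance along the unit normal. -/
theorem exists_tubular_neighborhood {r : EuclideanSpace ℝ (Fin n) → ℝ} (hr : ContDiff ℝ ∞ r)
    {Ω : Set (EuclideanSpace ℝ (Fin n))} (hΩ : Ω = {x | r x < 0})
    (hfr : {x | r x = 0} = frontier Ω) (hgr : ∀ p, r p = 0 → gradient r p ≠ 0)
    {b : EuclideanSpace ℝ (Fin n) → EuclideanSpace ℝ (Fin n)}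
    (hb : ∀ x, b x ∈ frontier Ω ∧ Metric.infDist x (frontier Ω) = dist x (b x)) :
    ∃ U : Set (EuclideanSpace ℝ (Fin n)), IsOpen U ∧ frontier Ω ⊆ U ∧
      ContDiffOn ℝ ∞ b U ∧ ContDiffOn ℝ ∞ (signedDistance Ω) U ∧
      ∀ x ∈ U, (∀ q ∈ frontier Ω, dist x q = Metric.infDist x (frontier Ω) → q = b x) ∧
        x = b x + signedDistance Ω x • ‖gradient r (b x)‖⁻¹ • gradient r (b x) := by
  have hmem : ∀ {q}, r q = 0 ↔ q ∈ frontier Ω := fun {q} => by rw [← hfr]; rfl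
  have hbr : ∀ x, r (b x) = 0 := fun x => hmem.2 (hb x).1
  -- The selection `b` is global, so local statements about it need no gluing: the union of all good
  -- open sets works.
  set P : Set (EuclideanSpace ℝ (Fin n)) → Prop := fun V =>
    ContDiffOn ℝ ∞ b V ∧ ContDiffOn ℝ ∞ (signedDistance Ω) V ∧
      ∀ x ∈ V, (∀ q ∈ frontier Ω, dist x q = Metric.infDist x (frontier Ω) → q = b x) ∧
        x = b x + signedDistance Ω x • ‖gradient r (b x)‖⁻¹ • gradient r (b x) with hP
  have hloc : ∀ p ∈ frontier Ω, ∃ V, IsOpen V ∧ p ∈ V ∧ P V := by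
    intro p hp
    obtain ⟨V, y, t, hVo, hpV, hy, ht, hV⟩ :=
      exists_smooth_nearest_point hr (hmem.2 hp) (hgr p (hmem.2 hp))
    have hnear : ∀ x q, dist x q = Metric.infDist x (frontier Ω) →
        ∀ p', r p' = 0 → dist x q ≤ dist x p' := fun x q hxq p' hp' => by
      rw [hxq]; exact Metric.infDist_le_dist_of_mem (hmem.1 hp')
    have hVb := fun x hx => hV x hx (b x) (hbr x) (hnear x (b x) (hb x).2.symm)
    have hby : ∀ x ∈ V, b x = y x := fun x hx => (hVb x hx).1
    have hbV : ContDiffOn ℝ ∞ b V := hy.congr hby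
    have hδ : ∀ x ∈ V, signedDistance Ω x = t x * ‖gradient r (b x)‖ := by
      intro x hx
      obtain ⟨-, hxt, -, hsign⟩ := hVb x hx
      have hdist : Metric.infDist x (frontier Ω) = |t x| * ‖gradient r (b x)‖ := by
        rw [(hb x).2]
        conv_lhs => lhs; rw [hxt]
        simp [norm_smul]
      have hxΩ : x ∈ Ω ↔ t x < 0 := by rw [← hsign, hΩ]; rfl
      unfold signedDistance
      rw [hdist]
      split_ifs with h
      · rw [abs_of_neg (hxΩ.1 h)]; ring
      · rw [abs_of_nonneg (not_lt.1 (mt hxΩ.2 h))]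
    refine ⟨V, hVo, hpV, hbV, ?_, fun x hx => ⟨fun q hq hxq => ?_, ?_⟩⟩
    · exact (ht.mul ((hr.gradient_infty.comp_contDiffOn hbV).norm ℝ
        fun x hx => (hVb x hx).2.2.1)).congr hδ
    · rw [hby x hx]
      exact (hV x hx q (hmem.2 hq) (hnear x q hxq)).1
    · rw [hδ x hx, smul_smul, mul_assoc, mul_inv_cancel₀ (norm_ne_zero_iff.2 (hVb x hx).2.2.1),
        mul_one]
      exact (hVb x hx).2.1
  have hex : ∀ x ∈ ⋃₀ {V | IsOpen V ∧ P V}, ∃ V, IsOpen V ∧ x ∈ V ∧ P V := by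
    rintro x ⟨V, ⟨hV, hPV⟩, hx⟩
    exact ⟨V, hV, hx, hPV⟩
  refine ⟨⋃₀ {V | IsOpen V ∧ P V}, isOpen_sUnion fun V hV => hV.1, fun p hp => ?_,
    fun x hx => ?_, fun x hx => ?_, fun x hx => ?_⟩
  · obtain ⟨V, hV, hpV, hPV⟩ := hloc p hp
    exact ⟨V, ⟨hV, hPV⟩, hpV⟩
  · obtain ⟨V, hV, hxV, hPV⟩ := hex x hx
    exact (hPV.1.contDiffAt (hV.mem_nhds hxV)).contDiffWithinAt
  · obtain ⟨V, hV, hxV, hPV⟩ := hex x hx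
    exact (hPV.2.1.contDiffAt (hV.mem_nhds hxV)).contDiffWithinAt
  · obtain ⟨V, hV, hxV, hPV⟩ := hex x hx
    exact hPV.2.2 x hxV

end Tubular

/-! ### Derivatives of the unit normal field. -/

section ShapeOperator

variable {E : Type*} [NormedAddCommGroup E] [InnerProductSpace ℝ E]

theorem inner_fderiv_eq_zero_of_norm_eq_one {ν : E → E} {U : Set E} (hU : IsOpen U)
    (hν : ContDiffOn ℝ ∞ ν U) (hone : ∀ x ∈ U, ‖ν x‖ = 1) {x : E} (hx : x ∈ U) (v : E) :
    inner ℝ (ν x) (fderiv ℝ ν x v) = 0 := by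
  have hd : HasFDerivAt ν (fderiv ℝ ν x) x :=
    ((hν.contDiffAt (hU.mem_nhds hx)).differentiableAt (by simp)).hasFDerivAt
  have h1 := (hd.inner ℝ hd)
  have h2 : HasFDerivAt (fun y => inner ℝ (ν y) (ν y)) (0 : E →L[ℝ] ℝ) x := by
    refine (hasFDerivAt_const (1 : ℝ) x).congr_of_eventuallyEq ?_
    filter_upwards [hU.mem_nhds hx] with y hy
    rw [real_inner_self_eq_norm_sq, hone y hy, one_pow]
  have h3 := congrArg (fun L : E →L[ℝ] ℝ => L v) (h1.unique h2)
  simp only [ContinuousLinearMap.comp_apply, ContinuousLinearMap.prod_apply,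
    fderivInnerCLM_apply, zero_apply] at h3
  rw [real_inner_comm (ν x) (fderiv ℝ ν x v)] at h3
  linarith

variable {U : Set E} {δ : E → ℝ} {b ν : E → E}

/-- Differentiating `x = b x + δ x • ν x`. -/
theorem fderiv_projection_eq (hU : IsOpen U) (hδ : ContDiffOn ℝ ∞ δ U) (hb : ContDiffOn ℝ ∞ b U)
    (hν : ContDiffOn ℝ ∞ ν U) (hdec : ∀ x ∈ U, x = b x + δ x • ν x) {x : E} (hx : x ∈ U) (v : E) :
    v = fderiv ℝ b x v + (δ x • fderiv ℝ ν x v + fderiv ℝ δ x v • ν x) := by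
  have hx' := hU.mem_nhds hx
  have dδ := ((hδ.contDiffAt hx').differentiableAt (by simp)).hasFDerivAt
  have db := ((hb.contDiffAt hx').differentiableAt (by simp)).hasFDerivAt
  have dν := ((hν.contDiffAt hx').differentiableAt (by simp)).hasFDerivAt
  have h1 := db.add (dδ.smul dν)
  have h2 : HasFDerivAt (b + δ • ν) (ContinuousLinearMap.id ℝ E) x := by
    refine (hasFDerivAt_id x).congr_of_eventuallyEq ?_
    filter_upwards [hx'] with y hy using (hdec y hy).symm
  exact congrArg (fun L : E →L[ℝ] E => L v) (h2.unique h1)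

/-- Pair the differentiated decomposition with `ν`: tangency removes the `Db` term and unit length
the `Dν` term. -/
theorem fderiv_eq_inner_normal (hU : IsOpen U) (hδ : ContDiffOn ℝ ∞ δ U)
    (hb : ContDiffOn ℝ ∞ b U) (hν : ContDiffOn ℝ ∞ ν U) (hdec : ∀ x ∈ U, x = b x + δ x • ν x)
    (hone : ∀ x ∈ U, ‖ν x‖ = 1) (htan : ∀ x ∈ U, ∀ v, inner ℝ (ν x) (fderiv ℝ b x v) = 0)
    {x : E} (hx : x ∈ U) : fderiv ℝ δ x = innerSL ℝ (ν x) := by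
  ext v
  have h := congrArg (fun w => inner ℝ (ν x) w) (fderiv_projection_eq hU hδ hb hν hdec hx v)
  simp only [inner_add_right, inner_smul_right, htan x hx v,
    inner_fderiv_eq_zero_of_norm_eq_one hU hν hone hx v, real_inner_self_eq_norm_sq,
    hone x hx] at h
  rw [innerSL_apply_apply, h]
  ring

/-- Since `ν = ∇δ`, this is the symmetry of the second derivative of `δ`. -/
theorem inner_fderiv_normal_symm (hU : IsOpen U) (hδ : ContDiffOn ℝ ∞ δ U)
    (hν : ContDiffOn ℝ ∞ ν U) (hgrad : ∀ x ∈ U, fderiv ℝ δ x = innerSL ℝ (ν x))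
    {x : E} (hx : x ∈ U) (v w : E) :
    inner ℝ (fderiv ℝ ν x v) w = inner ℝ (fderiv ℝ ν x w) v := by
  have hx' := hU.mem_nhds hx
  have dν := ((hν.contDiffAt hx').differentiableAt (by simp)).hasFDerivAt
  have h2 : HasFDerivAt (fderiv ℝ δ) ((innerSL ℝ (E := E)).comp (fderiv ℝ ν x)) x := by
    refine ((innerSL ℝ (E := E)).hasFDerivAt.comp x dν).congr_of_eventuallyEq ?_
    filter_upwards [hx'] with y hy using hgrad y hy
  have hs : IsSymmSndFDerivAt ℝ δ x := (hδ.contDiffAt hx').isSymmSndFDerivAt (by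
    simpa using (WithTop.coe_le_coe.2 (le_top : (2 : ℕ∞) ≤ ⊤) : (2 : WithTop ℕ∞) ≤ ∞))
  have := hs v w
  rw [h2.fderiv] at this
  exact this

/-- The shape operators of parallel hypersurfaces. -/
theorem fderiv_normal_eq (hU : IsOpen U) (hδ : ContDiffOn ℝ ∞ δ U)
    (hb : ContDiffOn ℝ ∞ b U) (hν : ContDiffOn ℝ ∞ ν U) (hdec : ∀ x ∈ U, x = b x + δ x • ν x)
    (hone : ∀ x ∈ U, ‖ν x‖ = 1) (htan : ∀ x ∈ U, ∀ v, inner ℝ (ν x) (fderiv ℝ b x v) = 0)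
    (hbU : ∀ x ∈ U, b x ∈ U) (hνb : ∀ x ∈ U, ν (b x) = ν x) {x : E} (hx : x ∈ U) :
    fderiv ℝ ν x = fderiv ℝ ν (b x) - δ x • (fderiv ℝ ν (b x) * fderiv ℝ ν x) := by
  have hx' := hU.mem_nhds hx
  have db := ((hb.contDiffAt hx').differentiableAt (by simp)).hasFDerivAt
  have dν := ((hν.contDiffAt (hU.mem_nhds (hbU x hx))).differentiableAt (by simp)).hasFDerivAt
  have hcomp : fderiv ℝ ν x = (fderiv ℝ ν (b x)).comp (fderiv ℝ b x) := by
    refine HasFDerivAt.fderiv ((dν.comp x db).congr_of_eventuallyEq ?_)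
    filter_upwards [hx'] with y hy using (hνb y hy).symm
  -- By symmetry `⟨Bν, v⟩ = ⟨Bv, ν⟩`, which vanishes because `ν` has unit length.
  have hker : fderiv ℝ ν (b x) (ν x) = 0 := by
    refine ext_inner_right ℝ fun v => ?_
    rw [inner_fderiv_normal_symm hU hδ hν
      (fun y hy => fderiv_eq_inner_normal hU hδ hb hν hdec hone htan hy) (hbU x hx),
      real_inner_comm, ← hνb x hx, inner_fderiv_eq_zero_of_norm_eq_one hU hν hone (hbU x hx),
      inner_zero_left]
  ext v
  have h := fderiv_projection_eq hU hδ hb hν hdec hx v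
  have h2 : fderiv ℝ b x v = v - δ x • fderiv ℝ ν x v - fderiv ℝ δ x v • ν x := by
    nth_rw 2 [h]; abel
  have h3 : fderiv ℝ ν x v = fderiv ℝ ν (b x) (fderiv ℝ b x v) := by
    nth_rw 1 [hcomp]; rfl
  rw [h3, h2]
  simp [map_sub, map_smul, hker]

/-- The hypothesis says `(1 + dB)A = B`. The Neumann series `S` inverts `1 + dB`, and `B` commutes
with `1 + dB`, which turns `SB` into `BS`. -/
theorem eq_mul_tsum_of_eq_sub_smul_mul {R : Type*} [NormedRing R] [NormedAlgebra ℝ R]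
    [CompleteSpace R] {A B : R} {d : ℝ} (h : A = B - d • (B * A)) (hd : ‖d • B‖ < 1) :
    Summable (fun m : ℕ => (-d) ^ m • B ^ m) ∧ A = B * ∑' m : ℕ, (-d) ^ m • B ^ m ∧
      (1 + d • B) * (∑' m : ℕ, (-d) ^ m • B ^ m) = 1 ∧
      (∑' m : ℕ, (-d) ^ m • B ^ m) * (1 + d • B) = 1 := by
  have hpow : (fun m : ℕ => (-d) ^ m • B ^ m) = fun m => (-(d • B)) ^ m := by
    funext m; rw [← neg_smul, smul_pow]
  have hd' : ‖-(d • B)‖ < 1 := by rwa [norm_neg]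
  have h1 := mul_neg_geom_series _ hd'
  have h2 := geom_series_mul_neg _ hd'
  rw [sub_neg_eq_add] at h1 h2
  rw [hpow]
  refine ⟨summable_geometric_of_norm_lt_one hd', ?_, h1, h2⟩
  set S := ∑' m : ℕ, (-(d • B)) ^ m with hS
  have hA : (1 + d • B) * A = B := by
    rw [add_mul, one_mul, smul_mul_assoc, ← eq_sub_iff_add_eq]
    exact h
  have hcomm : B * (1 + d • B) = (1 + d • B) * B := by
    simp [mul_add, add_mul]
  calc A = S * (1 + d • B) * A := by rw [h2, one_mul]
    _ = S * (B * ((1 + d • B) * S)) := by rw [mul_assoc, hA, h1, mul_one]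
    _ = S * (1 + d • B) * B * S := by rw [← mul_assoc B, hcomm]; simp only [mul_assoc]
    _ = B * S := by rw [h2, one_mul]

end ShapeOperator

/-! ### Passage to matrices and the main theorem. -/

theorem hessianMatrix_eq_toEuclideanCLM_symm {n : ℕ} {U : Set (EuclideanSpace ℝ (Fin n))}
    {δ : EuclideanSpace ℝ (Fin n) → ℝ} {ν : EuclideanSpace ℝ (Fin n) → EuclideanSpace ℝ (Fin n)}
    (hU : IsOpen U) (hδ : ContDiffOn ℝ ∞ δ U) (hν : ContDiffOn ℝ ∞ ν U)
    (hgrad : ∀ x ∈ U, fderiv ℝ δ x = innerSL ℝ (ν x)) {x : EuclideanSpace ℝ (Fin n)}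
    (hx : x ∈ U) :
    hessianMatrix δ x = (Matrix.toEuclideanCLM (n := Fin n) (𝕜 := ℝ)).symm (fderiv ℝ ν x) := by
  have hx' := hU.mem_nhds hx
  have dν := ((hν.contDiffAt hx').differentiableAt (by simp)).hasFDerivAt
  set M := (Matrix.toEuclideanCLM (n := Fin n) (𝕜 := ℝ)).symm (fderiv ℝ ν x) with hM
  have hMA : fderiv ℝ ν x = Matrix.toEuclideanCLM (n := Fin n) (𝕜 := ℝ) M := by simp [hM]
  ext j k
  have hp : HasFDerivAt (partialDerivative k δ)
      ((EuclideanSpace.proj k : EuclideanSpace ℝ (Fin n) →L[ℝ] ℝ).comp (fderiv ℝ ν x)) x := by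
    refine ((EuclideanSpace.proj k : EuclideanSpace ℝ (Fin n) →L[ℝ] ℝ).hasFDerivAt.comp x
      dν).congr_of_eventuallyEq ?_
    filter_upwards [hx'] with y hy
    simp [partialDerivative, hgrad y hy, EuclideanSpace.inner_single_right]
  have h1 : hessianMatrix δ x j k = fderiv ℝ ν x (EuclideanSpace.single j 1) k := by
    simp only [hessianMatrix, Matrix.of_apply]
    rw [partialDerivative, hp.fderiv]
    rfl
  -- Entry `(j, k)` of the Hessian is that of the transpose of `Dν`, so symmetry is needed.
  have hs := inner_fderiv_normal_symm hU hδ hν hgrad hx (EuclideanSpace.single j 1)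
    (EuclideanSpace.single k 1)
  simp only [EuclideanSpace.inner_single_right] at hs
  rw [h1]
  have h2 : fderiv ℝ ν x (EuclideanSpace.single j 1) k
      = fderiv ℝ ν x (EuclideanSpace.single k 1) j := by simpa using hs
  rw [h2, hMA, Matrix.ofLp_toEuclideanCLM]
  simp

theorem theoremT {n : ℕ} (Ω : Set (EuclideanSpace ℝ (Fin n)))
    (hΩ : IsSmoothlyBounded Ω) (hbdd : Bornology.IsBounded Ω) :
    ∃ (U : Set (EuclideanSpace ℝ (Fin n)))
      (b : EuclideanSpace ℝ (Fin n) → EuclideanSpace ℝ (Fin n)),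
      IsOpen U ∧ frontier Ω ⊆ U ∧
      -- the signed distance is smooth on `U`, so its Hessian matrix is the classical one
      ContDiffOn ℝ ∞ (signedDistance Ω) U ∧
      -- `b x` is the unique nearest boundary point of `x`
      (∀ x ∈ U, b x ∈ frontier Ω ∧ ‖b x - x‖ = |signedDistance Ω x| ∧
        ∀ p ∈ frontier Ω, ‖p - x‖ = |signedDistance Ω x| → p = b x) ∧
      ∀ x ∈ U,
        Summable (fun m : ℕ =>
          (-signedDistance Ω x) ^ m • hessianMatrix (signedDistance Ω) (b x) ^ m) ∧
        hessianMatrix (signedDistance Ω) x =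
          hessianMatrix (signedDistance Ω) (b x) *
            ∑' m : ℕ, (-signedDistance Ω x) ^ m • hessianMatrix (signedDistance Ω) (b x) ^ m ∧
        IsUnit (1 + signedDistance Ω x • hessianMatrix (signedDistance Ω) (b x)) ∧
        hessianMatrix (signedDistance Ω) x =
          hessianMatrix (signedDistance Ω) (b x) *
            (1 + signedDistance Ω x • hessianMatrix (signedDistance Ω) (b x))⁻¹ := by
  obtain ⟨-, r, hr, hΩr, hfr, W, -, hrW, hW⟩ := hΩ
  rcases (frontier Ω).eq_empty_or_nonempty with he | hne
  · exact ⟨∅, id, isOpen_empty, he.subset, contDiffOn_empty, by simp, by simp⟩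
  have hcpt : IsCompact (frontier Ω) :=
    Metric.isCompact_of_isClosed_isBounded isClosed_frontier (hbdd.closure.subset
      frontier_subset_closure)
  choose b hb using fun x => hcpt.exists_infDist_eq_dist hne x
  have hgr : ∀ p, r p = 0 → gradient r p ≠ 0 := fun p hp => hW p (hrW hp)
  obtain ⟨U, hU, hΓU, hbU, hδU, h⟩ := exists_tubular_neighborhood hr hΩr hfr hgr hb
  set δ := signedDistance Ω with hδ
  set ν : EuclideanSpace ℝ (Fin n) → EuclideanSpace ℝ (Fin n) :=
    fun x => ‖gradient r (b x)‖⁻¹ • gradient r (b x) with hν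
  have hrb : ∀ x, r (b x) = 0 := fun x => by
    have := (hb x).1
    rwa [← hfr] at this
  have hgb : ∀ x, ‖gradient r (b x)‖ ≠ 0 := fun x => norm_ne_zero_iff.2 (hgr _ (hrb x))
  have hδΓ : ∀ p ∈ frontier Ω, δ p = 0 := fun p hp => by
    rw [← abs_eq_zero, abs_signedDistance, Metric.infDist_zero_of_mem hp]
  have hbb : ∀ x, b (b x) = b x := fun x => by
    have := (hb (b x)).2
    rw [Metric.infDist_zero_of_mem (hb x).1] at this
    exact (dist_eq_zero.1 this.symm).symm
  have hνU : ContDiffOn ℝ ∞ ν U :=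
    ((((hr.gradient_infty.comp_contDiffOn hbU).norm ℝ fun x _ => hgr _ (hrb x))).inv
      fun x _ => hgb x).smul (hr.gradient_infty.comp_contDiffOn hbU)
  have hdec : ∀ x ∈ U, x = b x + δ x • ν x := fun x hx => (h x hx).2
  have hone : ∀ x ∈ U, ‖ν x‖ = 1 := fun x _ => by
    rw [hν, norm_smul, norm_inv, norm_norm, inv_mul_cancel₀ (hgb x)]
  have hνb : ∀ x ∈ U, ν (b x) = ν x := fun x _ => by simp only [hν, hbb]
  have hbmem : ∀ x ∈ U, b x ∈ U := fun x _ => hΓU (hb x).1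
  -- Differentiate `r ∘ b = 0`.
  have htan : ∀ x ∈ U, ∀ v, inner ℝ (ν x) (fderiv ℝ b x v) = 0 := fun x hx v => by
    have db := ((hbU.contDiffAt (hU.mem_nhds hx)).differentiableAt (by simp)).hasFDerivAt
    have dr := ((hr.differentiable (by simp)) (b x)).hasFDerivAt
    have h0 : r ∘ b = fun _ => 0 := funext hrb
    have h1 := dr.comp x db
    rw [h0] at h1
    have h2 := congrArg (fun L : EuclideanSpace ℝ (Fin n) →L[ℝ] ℝ => L v)
      (h1.unique (hasFDerivAt_const (0 : ℝ) x))
    have h3 : fderiv ℝ r (b x) (fderiv ℝ b x v) = 0 := h2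
    rw [hν, real_inner_smul_left, inner_gradient_left, h3, mul_zero]
  have hgrad : ∀ x ∈ U, fderiv ℝ δ x = innerSL ℝ (ν x) := fun x hx =>
    fderiv_eq_inner_normal hU hδU hbU hνU hdec hone htan hx
  have hAcont : ContinuousOn (fun x => ‖δ x • fderiv ℝ ν (b x)‖) U :=
    (hδU.continuousOn.smul ((hνU.continuousOn_fderiv_of_isOpen hU (by simp)).comp
      hbU.continuousOn hbmem)).norm
  -- Shrinking to `‖δB‖ < 1` keeps the boundary inside, because `δ = 0` there.
  refine ⟨U ∩ (fun x => ‖δ x • fderiv ℝ ν (b x)‖) ⁻¹' Set.Iio 1, b,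
    hAcont.isOpen_inter_preimage hU isOpen_Iio, fun p hp => ⟨hΓU hp, ?_⟩,
    hδU.mono Set.inter_subset_left, fun x hx => ⟨(hb x).1, ?_, fun p hp hpx => ?_⟩,
    fun x ⟨hx, hx1⟩ => ?_⟩
  · change ‖δ p • fderiv ℝ ν (b p)‖ < 1
    rw [hδΓ p hp, zero_smul ℝ (fderiv ℝ ν (b p)), norm_zero]
    exact one_pos
  · rw [abs_signedDistance, (hb x).2, dist_comm, dist_eq_norm]
  · rw [abs_signedDistance] at hpx
    exact (h x hx.1).1 p hp (by rw [dist_comm, dist_eq_norm, hpx])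
  obtain ⟨hsum, hA, hl, hr'⟩ := eq_mul_tsum_of_eq_sub_smul_mul
    (fderiv_normal_eq hU hδU hbU hνU hdec hone htan hbmem hνb hx) hx1
  -- `T` is an algebra isomorphism, and its continuity carries the operator series to the matrix
  -- series.
  set T := (Matrix.toEuclideanCLM (n := Fin n) (𝕜 := ℝ)).symm with hT
  have hTc : Continuous T :=
    LinearMap.continuous_of_finiteDimensional (T.toAlgEquiv.toLinearMap)
  rw [hessianMatrix_eq_toEuclideanCLM_symm hU hδU hνU hgrad hx,
    hessianMatrix_eq_toEuclideanCLM_symm hU hδU hνU hgrad (hbmem x hx), ← hT]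
  set A := fderiv ℝ ν x
  set B := fderiv ℝ ν (b x)
  have hTm : ∀ m : ℕ, T ((-δ x) ^ m • B ^ m) = (-δ x) ^ m • T B ^ m := fun m => by
    rw [map_smul, map_pow]
  have hhas : HasSum (fun m : ℕ => (-δ x) ^ m • T B ^ m) (T (∑' m : ℕ, (-δ x) ^ m • B ^ m)) := by
    have := hsum.hasSum.map T hTc
    simpa only [Function.comp_def, hTm] using this
  have hl' : (1 + δ x • T B) * T (∑' m : ℕ, (-δ x) ^ m • B ^ m) = 1 := by
    rw [← map_smul, ← map_one T, ← map_add, ← map_mul, hl]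
  have hTA : T A = T B * T (∑' m : ℕ, (-δ x) ^ m • B ^ m) := by
    rw [← map_mul, ← hA]
  refine ⟨hhas.summable, ?_, IsUnit.of_mul_eq_one _ hl', ?_⟩
  · rw [hhas.tsum_eq, hTA]
  · rw [Matrix.inv_eq_right_inv hl', hTA]
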